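/- Let $\Sigma=\{0,1,2,3\}$ and $n\ge 1$. A line of $\Sigma^m$ is a set of four words that agree in all coordinates but one. For $m\ge1$, a function $f:\Sigma^m\to\Sigma$ is an $m$-quasigroup (of order $4$) if for each $i\in\{1,\dots,m\}$, each $y\in\Sigma$ and each choice of the arguments $x_t$, $t\neq i$, there is an $x_i\in\Sigma$ with $f(x_1,\dots,x_m)=y$. A set $T\subseteq\Sigma^m$ is a double-code if every line of $\Sigma^m$ contains $0$ or $2$ elements of $T$, and a double-MDS-code if every line contains exactly $2$ elements of $T$. A double-code is prime if it is nonempty, is contained in some double-MDS-code, and cannot be partitioned into more than one nonempty double-codes. Let $\chi_T$ denote the characteristic function of $T$, and $\oplus$ addition modulo $2$. Let $g$ be an $n$-quasigroup, let $a\ne b$ be elements of $\Sigma$, and let $S=g^{-1}(\{a,b\})$. Then there is exactly one way, up to the order of the blocks, to choose a partition of the index set $\{1,\dots,n\}$ into nonempty blocks $K_1,\dots,K_k$, $K_j=\{i_{j,1}<\dots<i_{j,n_j}\}$, prime double-MDS-codes $S_j\subseteq\Sigma^{n_j}$ containing the zero word ($j=1,\dots,k$), and a constant $\sigma_0\in\{0,1\}$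 such that $$\chi_S(x_1,\dots,x_n)=\chi_{S_1}(\tilde x_1)\oplus\dots\oplus\chi_{S_k}(\tilde x_k)\oplus\sigma_0\quad\text{for all }(x_1,\dots,x_n)\in\Sigma^n,\qquad \tilde x_j=(x_{i_{j,1}},\dots,x_{i_{j,n_j}}).$$ Moreover, for this partition there exist a $k$-quasigroup $g_0$ and $n_j$-quasigroups $g_j$ ($j=1,\dots,k$) such that $$g(x_1,\dots,x_n)=g_0\bigl(g_1(\tilde x_1),\dots,g_k(\tilde x_k)\bigr)\quad\text{for all }(x_1,\dots,x_n)\in\Sigma^n.$$ -/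

import Mathlib

namespace FourAry

/-- Words over the alphabet `{0,1,2,3}` with coordinates indexed by `ι`. -/
abbrev Word (ι : Type*) : Type _ := ι → Fin 4

/-- The `i`-line through `x`: all words that agree with `x` outside the coordinate `i`. -/
def line {ι : Type*} (i : ι) (x : Word ι) : Set (Word ι) :=
  {y | ∀ j, j ≠ i → y j = x j}

/-- Every line contains zero or two elements of `S`. -/
def IsDoubleCode {ι : Type*} (S : Set (Word ι)) : Prop :=
  ∀ (i : ι) (x : Word ι), (S ∩ line i x).ncard = 0 ∨ (S ∩ line i x).ncard = 2

/-- Every line contains exactly two elements of `S`. -/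
def IsDoubleMDSCode {ι : Type*} (S : Set (Word ι)) : Prop :=
  ∀ (i : ι) (x : Word ι), (S ∩ line i x).ncard = 2

/-- A double-code that is contained in some double-MDS-code. -/
def IsComplementable {ι : Type*} (S : Set (Word ι)) : Prop :=
  IsDoubleCode S ∧ ∃ T : Set (Word ι), IsDoubleMDSCode T ∧ S ⊆ T

/-- A nonempty complementable double-code that cannot be split into nonempty double-codes.
It suffices to exclude splittings into two parts: if a double-code is partitioned into
double-codes, then the union of any of the parts is again a double-code. -/
def IsPrimeCode {ι : Type*} (S : Set (Word ι)) : Prop :=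
  IsComplementable S ∧ S.Nonempty ∧
    ∀ A B : Set (Word ι), IsDoubleCode A → IsDoubleCode B → Disjoint A B → A ∪ B = S →
      A = ∅ ∨ B = ∅

/-- `g` is a quasigroup of order 4 with arguments indexed by `ι`: for each `i`, each value `y`
and each choice of the other arguments there is an `i`th argument at which `g` takes the
value `y`. -/
def IsQuasigroup {ι : Type*} [DecidableEq ι] (g : Word ι → Fin 4) : Prop :=
  ∀ (i : ι) (x : Word ι) (y : Fin 4), ∃ a : Fin 4, g (Function.update x i a) = y

/-- The characteristic function of `S`, with values in the two-element group. -/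
noncomputable def charFun {ι : Type*} (S : Set (Word ι)) (x : Word ι) : ZMod 2 :=
  S.indicator (fun _ => 1) x

/-- The subword of `x` formed by the coordinates in `K`. -/
def subword {n : ℕ} (x : Word (Fin n)) (K : Finset (Fin n)) : Word K :=
  fun i => x i

/-- A partition of the `n` coordinates into nonempty blocks, a set of words over each of the
blocks, and a constant. -/
structure Decomposition (n : ℕ) where
  blocks : Finpartition (Finset.univ : Finset (Fin n))
  code : (K : blocks.parts) → Set (Word K.1)
  const : ZMod 2

/-- `D` represents the characteristic function of `S` as the mod 2 sum of `D.const` and of the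
characteristic functions, over the disjoint blocks of variables, of prime double-MDS-codes that
contain the zero word. -/
structure Decomposition.Represents {n : ℕ} (D : Decomposition n) (S : Set (Word (Fin n))) :
    Prop where
  double_mds : ∀ K, IsDoubleMDSCode (D.code K)
  prime : ∀ K, IsPrimeCode (D.code K)
  zero_mem : ∀ K, (fun _ => 0) ∈ D.code K
  sum_eq : ∀ x : Word (Fin n),
    charFun S x = (∑ K : D.blocks.parts, charFun (D.code K) (subword x K.1)) + D.const

end FourAry

namespace FourAry

open Function

/-! Let F be the characteristic function of S; it takes each value twice on every line. Call a
component a class of words joined by moves along lines that preserve F. A move in direction i that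
changes F induces a well-defined involution on components, `Balanced.flip`, and these involutions
commute. Group the indices with equal flips into blocks. Indices with different flips have zero
mixed difference (`Balanced.mixed_difference`), so F is a sum over the blocks. Inside a block all
flips coincide, so the summand has connected level sets (`Balanced.connected_restrict`), which makes
its code prime.

The decomposition is unique because a prime double-MDS-code cannot separate its variables
(`IsPrimeCode.eq_univ_of_separates`). Finally, a nontrivial move inside S or its complement always
changes g by the involution `partner`, whatever the other variables are; by connectedness, g then
depends on a block only through its own restriction to it (`IsQuasigroup.glue_eq_glue`). -/

/-- On every line, `F` takes each of its two values exactly twice. -/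
def Balanced {ι : Type*} [DecidableEq ι] (F : Word ι → ZMod 2) : Prop :=
  ∀ (i : ι) (x : Word ι) (c : ZMod 2),
    (Finset.univ.filter fun a => F (update x i a) = c).card = 2

/-- Two words with the same value of `F` that lie on a common line. -/
def Step {ι : Type*} [DecidableEq ι] (F : Word ι → ZMod 2) (x y : Word ι) : Prop :=
  F x = F y ∧ ∃ i a, y = update x i a

theorem eq_of_ne_of_ne {a b c : ZMod 2} (h : a ≠ c) (h' : b ≠ c) : a = b := by
  revert a b c; decide

/-- Each function differs from its value at `a` at two of the three remaining symbols, so these two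
pairs meet. -/
theorem exists_ne_and_ne {f g : Fin 4 → ZMod 2}
    (hf : ∀ c, (Finset.univ.filter fun a => f a = c).card = 2)
    (hg : ∀ c, (Finset.univ.filter fun a => g a = c).card = 2) (a : Fin 4) :
    ∃ b, f b ≠ f a ∧ g b ≠ g a := by
  by_contra! h
  have hne : ∀ c : ZMod 2, c + 1 ≠ c := by decide
  have hsub : (Finset.univ.filter fun b => f b = f a + 1) ∪
      (Finset.univ.filter fun b => g b = g a + 1) ⊆ Finset.univ.erase a := by
    intro b hb
    simp only [Finset.mem_union, Finset.mem_filter, Finset.mem_univ, true_and] at hb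
    simp only [Finset.mem_erase, Finset.mem_univ, and_true]
    rintro rfl
    rcases hb with hb | hb <;> exact hne _ hb.symm
  have hdisj : Disjoint (Finset.univ.filter fun b => f b = f a + 1)
      (Finset.univ.filter fun b => g b = g a + 1) := by
    rw [Finset.disjoint_left]
    intro b hb hb'
    simp only [Finset.mem_filter, Finset.mem_univ, true_and] at hb hb'
    have h1 := h b (by rw [hb]; exact hne _)
    rw [h1] at hb'
    exact hne _ hb'.symm
  have := Finset.card_le_card hsub
  rw [Finset.card_union_of_disjoint hdisj, hf, hg] at this
  simp at this

/-! ### Components of the level sets and their flips -/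

section

variable {ι : Type*} [DecidableEq ι] {F : Word ι → ZMod 2}

theorem Balanced.exists_ne (hF : Balanced F) (i : ι) (x : Word ι) :
    ∃ a, F (update x i a) ≠ F x := by
  obtain ⟨a, ha, -⟩ := exists_ne_and_ne (hF i x) (hF i x) (x i)
  exact ⟨a, by simpa using ha⟩

theorem Balanced.exists_eq (hF : Balanced F) (i : ι) (x : Word ι) (c : ZMod 2) :
    ∃ a, F (update x i a) = c := by
  have h : 0 < (Finset.univ.filter fun a => F (update x i a) = c).card := by rw [hF]; norm_num
  obtain ⟨a, ha⟩ := Finset.card_pos.1 h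
  exact ⟨a, by simpa using ha⟩

theorem Step.symm {x y : Word ι} (h : Step F x y) : Step F y x := by
  obtain ⟨h, i, a, rfl⟩ := h
  exact ⟨h.symm, i, x i, by simp⟩

/-- The connected components of the two level sets of `F`. -/
def Component (F : Word ι → ZMod 2) : Type _ := Quot (Step F)

/-- The component of a word. -/
def component (F : Word ι → ZMod 2) (x : Word ι) : Component F := Quot.mk _ x

theorem component_update {x : Word ι} {i : ι} {a : Fin 4} (h : F (update x i a) = F x) :
    component F (update x i a) = component F x :=
  (Quot.sound ⟨h.symm, i, a, rfl⟩).symm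

theorem component_update_eq_update {x : Word ι} {i : ι} {a b : Fin 4}
    (h : F (update x i a) = F (update x i b)) :
    component F (update x i a) = component F (update x i b) :=
  Quot.sound ⟨h, i, b, by simp⟩

/-- The component reached from a given one by a step in the direction `i` that changes `F`. -/
noncomputable def Balanced.flip (hF : Balanced F) (i : ι) : Component F → Component F :=
  Quot.lift (fun x => component F (update x i (hF.exists_ne i x).choose)) <| by
    rintro x y ⟨hxy, j, b, rfl⟩
    have hx := (hF.exists_ne i x).choose_spec
    have hy := (hF.exists_ne i (update x j b)).choose_spec
    generalize (hF.exists_ne i x).choose = a at hx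
    generalize (hF.exists_ne i (update x j b)).choose = a' at hy
    by_cases hij : j = i
    · subst hij
      simp only [update_idem] at hy ⊢
      exact component_update_eq_update (eq_of_ne_of_ne hx (hxy ▸ hy))
    -- The symbol `c` changes `F` on both parallel `i`-lines; the two words reached are then joined
    -- by a `j`-step.
    · obtain ⟨c, hc, hc'⟩ := exists_ne_and_ne (hF i x) (hF i (update x j b)) (x i)
      have e : update (update x j b) i (x i) = update x j b := by
        conv_lhs => rw [show x i = (update x j b) i by rw [update_of_ne (Ne.symm hij)]]
        simp
      rw [update_eq_self] at hc
      rw [e] at hc'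
      rw [component_update_eq_update (eq_of_ne_of_ne hx hc),
        component_update_eq_update (eq_of_ne_of_ne hy hc')]
      rw [update_comm hij] at hc' ⊢
      exact (component_update (eq_of_ne_of_ne hc' (hxy ▸ hc))).symm

theorem Balanced.flip_component (hF : Balanced F) {i : ι} {x : Word ι} {a : Fin 4}
    (h : F (update x i a) ≠ F x) :
    hF.flip i (component F x) = component F (update x i a) :=
  component_update_eq_update (eq_of_ne_of_ne (hF.exists_ne i x).choose_spec h)

theorem Balanced.flip_flip (hF : Balanced F) (i : ι) (q : Component F) :
    hF.flip i (hF.flip i q) = q := by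
  induction q using Quot.ind with | mk x => ?_
  change hF.flip i (hF.flip i (component F x)) = component F x
  obtain ⟨a, ha⟩ := hF.exists_ne i x
  rw [hF.flip_component ha, hF.flip_component (a := x i) (by simpa using ha.symm)]
  simp

theorem Balanced.flip_comm (hF : Balanced F) (i j : ι) (q : Component F) :
    hF.flip i (hF.flip j q) = hF.flip j (hF.flip i q) := by
  induction q using Quot.ind with | mk x => ?_
  change hF.flip i (hF.flip j (component F x)) = hF.flip j (hF.flip i (component F x))
  by_cases hij : i = j
  · rw [hij]
  obtain ⟨a, ha⟩ := hF.exists_ne i x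
  obtain ⟨b, hb, hb'⟩ := exists_ne_and_ne (hF j x) (hF j (update x i a)) (x j)
  have e : update (update x i a) j (x j) = update x i a := by
    conv_lhs => rw [show x j = (update x i a) j by rw [update_of_ne (Ne.symm hij)]]
    simp
  rw [update_eq_self] at hb
  rw [e] at hb'
  rw [hF.flip_component ha, hF.flip_component hb, hF.flip_component hb', update_comm hij] at *
  rw [hF.flip_component]
  rw [eq_of_ne_of_ne hb' ha.symm]
  exact hb.symm

theorem word_induction (P : Word ι → Prop) (T : Finset ι) {x y : Word ι}
    (h : ∀ j ∉ T, x j = y j) (hx : P x)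
    (hP : ∀ z, ∀ j ∈ T, ∀ a, P z → P (update z j a)) : P y := by
  induction T using Finset.induction_on generalizing x with
  | empty =>
    have : x = y := funext fun j => h j (by simp)
    exact this ▸ hx
  | insert i T hi ih =>
    refine ih (x := update x i (y i)) ?_ (hP _ _ (by simp) _ hx) ?_
    · intro j hj
      by_cases hji : j = i
      · subst hji; simp
      · rw [update_of_ne hji]; exact h j (by simp [hji, hj])
    · exact fun z j hj => hP z j (by simp [hj])

theorem Balanced.component_update_or (hF : Balanced F) (x : Word ι) (i : ι) (a : Fin 4) :
    component F (update x i a) = component F x ∨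
      component F (update x i a) = hF.flip i (component F x) := by
  by_cases h : F (update x i a) = F x
  · exact .inl (component_update h)
  · exact .inr (hF.flip_component h).symm

/-- Flips commute, and every component is reached from `q` by flips. -/
theorem Balanced.flip_eq_flip [Fintype ι] (hF : Balanced F) {i j : ι} {q : Component F}
    (h : hF.flip i q = hF.flip j q) : hF.flip i = hF.flip j := by
  funext r
  induction q using Quot.ind with | mk x => ?_
  induction r using Quot.ind with | mk y => ?_
  refine word_induction (fun y => hF.flip i (component F y) = hF.flip j (component F y))
    Finset.univ (x := x) (by simp) h ?_
  intro z k _ a hz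
  rcases hF.component_update_or z k a with e | e
  · rw [e, hz]
  · rw [e, hF.flip_comm, hz, hF.flip_comm]

theorem Balanced.mixed_difference [Fintype ι] (hF : Balanced F) {i j : ι}
    (h : hF.flip i ≠ hF.flip j) (x : Word ι) (a b : Fin 4) :
    F x + F (update x i a) = F (update x j b) + F (update (update x j b) i a) := by
  have hij : i ≠ j := by rintro rfl; exact h rfl
  -- A rectangle with odd sum has a corner `z` that differs from the other three. Its two neighbours
  -- are joined through the opposite corner, so the two flips agree at `z`.
  have key : ∀ (z : Word ι) (a b : Fin 4), F (update z i a) ≠ F z → F (update z j b) ≠ F z →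
      F (update (update z j b) i a) ≠ F z → False := by
    intro z a b h1 h2 h3
    refine h (hF.flip_eq_flip (q := component F z) ?_)
    rw [hF.flip_component h1, hF.flip_component h2]
    rw [← component_update (eq_of_ne_of_ne h3 h2)]
    rw [update_comm hij.symm] at h3 ⊢
    exact (component_update (eq_of_ne_of_ne h3 h1)).symm
  have ei : ∀ c, update (update x j c) i (x i) = update x j c := fun c => by
    conv_lhs => rw [show x i = (update x j c) i by rw [update_of_ne hij]]
    simp
  have k1 := key x a b
  have k2 := key (update x i a) (x i) b
  have k3 := key (update x j b) a (x j)
  have k4 := key (update (update x j b) i a) (x i) (x j)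
  simp only [update_idem, update_eq_self, ei, update_comm hij] at k1 k2 k3 k4 ⊢
  have : ∀ p q r s : ZMod 2, (q ≠ p → r ≠ p → s ≠ p → False) → (p ≠ q → s ≠ q → r ≠ q → False) →
    (s ≠ r → p ≠ r → q ≠ r → False) → (r ≠ s → q ≠ s → p ≠ s → False) → p + q = r + s := by
    simp only [imp_false]; decide
  exact this _ _ _ _ k1 k2 k3 k4

end

/-! ### Separation of variables -/

section

variable {ι : Type*} [DecidableEq ι] {F : Word ι → ZMod 2}

/-- `F` is the sum of a function of the variables in `K` and of a function of the other
variables. -/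
def Separates (F : Word ι → ZMod 2) (K : Finset ι) : Prop :=
  ∀ x y, F x + F y = F (K.piecewise x y) + F (K.piecewise y x)

/-- Increments of `F` along `K` do not depend on the coordinates outside `K`; add them up. -/
theorem separates_of_mixed_difference [Fintype ι] {K : Finset ι}
    (h : ∀ i ∈ K, ∀ j ∉ K, ∀ (x : Word ι) (a b : Fin 4),
      F x + F (update x i a) = F (update x j b) + F (update (update x j b) i a)) :
    Separates F K := by
  have h1 : ∀ i ∈ K, ∀ a, ∀ x y : Word ι, (∀ k ∈ K, x k = y k) →
      F x + F (update x i a) = F y + F (update y i a) := by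
    intro i hi a x y hxy
    refine word_induction (fun z => F x + F (update x i a) = F z + F (update z i a)) Kᶜ
      (x := x) (fun k hk => hxy k (by simpa using hk)) rfl ?_
    intro z j hj b hz
    rw [hz]
    exact h i hi j (by simpa using hj) z a b
  intro x y
  have h2 : F x + F (K.piecewise x y) = F (K.piecewise y x) + F y := by
    have := word_induction
      (fun z => F x + F (K.piecewise x y) = F z + F (K.piecewise z y)) K
      (x := x) (y := K.piecewise y x) (fun k hk => by simp [hk]) rfl ?_
    · simpa [Finset.piecewise_same] using this
    intro z i hi a hz
    have := h1 i hi a z (K.piecewise z y) (fun k hk => by simp [hk])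
    rw [Finset.update_piecewise_of_mem (s := K) (hi := hi)] at this
    rw [hz]
    generalize F x + F (K.piecewise x y) = t at *
    generalize F z = p, F (update z i a) = q, F (K.piecewise z y) = r,
      F (K.piecewise (update z i a) y) = s at *
    clear h h1
    revert t p q r s; decide
  generalize F x = p, F y = q, F (K.piecewise x y) = r, F (K.piecewise y x) = s at *
  clear h h1
  revert p q r s; decide

/-- The value of `F` on a component. -/
def Component.value : Component F → ZMod 2 := Quot.lift F fun _ _ h => h.1

theorem Balanced.value_flip (hF : Balanced F) (i : ι) (q : Component F) :
    (hF.flip i q).value ≠ q.value := by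
  induction q using Quot.ind with | mk x => ?_
  change (hF.flip i (component F x)).value ≠ F x
  obtain ⟨a, ha⟩ := hF.exists_ne i x
  rw [hF.flip_component ha]
  exact ha

/-- With a single common flip, changing coordinates in `K` reaches at most two components, and `F`
tells them apart. -/
theorem Balanced.component_eq (hF : Balanced F) {K : Finset ι}
    (hK : ∀ i ∈ K, ∀ j ∈ K, hF.flip i = hF.flip j) {x y : Word ι}
    (hxy : ∀ i ∉ K, x i = y i) (h : F x = F y) : component F x = component F y := by
  have := word_induction (fun z => component F z = component F x ∨
    ∃ i ∈ K, component F z = hF.flip i (component F x)) K hxy (.inl rfl) ?_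
  · rcases this with e | ⟨i, -, e⟩
    · exact e.symm
    · have := hF.value_flip i (component F x)
      rw [← e] at this
      exact absurd h.symm this
  intro z j hj a hz
  rcases hF.component_update_or z j a with e | e
  · rwa [e]
  · rw [e]
    rcases hz with hz | ⟨i, hi, hz⟩
    · exact .inr ⟨j, hj, by rw [hz]⟩
    · exact .inl (by rw [hz, hK j hj i hi, hF.flip_flip])

end

/-! ### Restriction to a block -/

section

variable {n : ℕ} {F : Word (Fin n) → ZMod 2}

/-- The word equal to `u` on `K` and to `w` elsewhere. -/
def glue (K : Finset (Fin n)) (u : Word K) (w : Word (Fin n)) : Word (Fin n) :=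
  fun i => if h : i ∈ K then u ⟨i, h⟩ else w i

@[simp]
theorem subword_glue (K : Finset (Fin n)) (u : Word K) (w : Word (Fin n)) :
    subword (glue K u w) K = u := by
  funext i; simp [subword, glue]

@[simp]
theorem glue_subword (K : Finset (Fin n)) (x w : Word (Fin n)) :
    glue K (subword x K) w = K.piecewise x w := by
  funext i; by_cases h : i ∈ K <;> simp [subword, glue, h]

theorem glue_update (K : Finset (Fin n)) (u : Word K) (w : Word (Fin n)) (i : K) (a : Fin 4) :
    glue K (update u i a) w = update (glue K u w) i a := by
  funext j
  by_cases hj : j ∈ K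
  · by_cases hji : j = i
    · subst hji; simp [glue]
    · have : (⟨j, hj⟩ : K) ≠ i := fun e => hji (by rw [← e])
      simp [glue, hj, hji, this]
  · have : j ≠ i := fun e => hj (e ▸ i.2)
    simp [glue, hj, this]

theorem subword_update_of_mem {K : Finset (Fin n)} {i : Fin n} (hi : i ∈ K)
    (x : Word (Fin n)) (a : Fin 4) :
    subword (update x i a) K = update (subword x K) ⟨i, hi⟩ a := by
  funext j
  simp only [subword, update_apply, Subtype.ext_iff]

theorem subword_update_of_notMem {K : Finset (Fin n)} {i : Fin n} (hi : i ∉ K)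
    (x : Word (Fin n)) (a : Fin 4) :
    subword (update x i a) K = subword x K := by
  funext j
  have : j.1 ≠ i := fun e => hi (e ▸ j.2)
  simp [subword, this]

/-- The function of the variables in `K` obtained from `f` by giving the others the value `0`. -/
def restrict {α : Type*} (f : Word (Fin n) → α) (K : Finset (Fin n)) : Word K → α :=
  fun u => f (glue K u 0)

theorem Balanced.restrict (hF : Balanced F) (K : Finset (Fin n)) : Balanced (restrict F K) := by
  intro i u c
  simp only [FourAry.restrict, glue_update]
  exact hF _ _ _

theorem Separates.glue {K : Finset (Fin n)} (h : Separates F K) (u : Word K)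
    (w : Word (Fin n)) :
    F (glue K u w) + F 0 = restrict F K u + F (K.piecewise 0 w) := by
  have := h (FourAry.glue K u w) 0
  rw [this, ← glue_subword, subword_glue]
  congr 2
  funext i
  by_cases hi : i ∈ K <;> simp [hi, FourAry.glue]

theorem Separates.restrict_subword {K : Finset (Fin n)} (h : Separates F K)
    (x : Word (Fin n)) :
    F x + F 0 = restrict F K (subword x K) + F (K.piecewise 0 x) := by
  simpa [Finset.piecewise_same] using h.glue (subword x K) x

theorem Separates.eqvGen_step_subword {K : Finset (Fin n)} (h : Separates F K)
    {x y : Word (Fin n)} (hxy : Relation.EqvGen (Step F) x y) :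
    Relation.EqvGen (Step (restrict F K)) (subword x K) (subword y K) := by
  induction hxy with
  | refl => exact .refl _
  | symm _ _ _ ih => exact .symm _ _ ih
  | trans _ _ _ _ _ ih ih' => exact .trans _ _ _ ih ih'
  | rel x y hxy =>
    obtain ⟨hF, i, a, rfl⟩ := hxy
    by_cases hi : i ∈ K
    · refine .rel _ _ ⟨?_, ⟨i, hi⟩, a, subword_update_of_mem hi x a⟩
      have h1 := h.restrict_subword x
      have h2 := h.restrict_subword (update x i a)
      have : K.piecewise (0 : Word (Fin n)) (update x i a) = K.piecewise 0 x := by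
        funext j
        by_cases hj : j ∈ K
        · simp [hj]
        · have : j ≠ i := fun e => hj (e ▸ hi)
          simp [hj, this]
      rw [← hF, h1, this] at h2
      exact add_right_cancel h2
    · rw [subword_update_of_notMem hi]
      exact .refl _

/-- Each of the level sets of `F` is connected. -/
def Connected {ι : Type*} [DecidableEq ι] (F : Word ι → ZMod 2) : Prop :=
  ∀ u v, F u = F v → Relation.EqvGen (Step F) u v

/-- The path given by `Balanced.component_eq` may leave `K`; separation lets it be projected back to
`K`. -/
theorem Balanced.connected_restrict (hF : Balanced F) {K : Finset (Fin n)}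
    (hK : ∀ i ∈ K, ∀ j ∈ K, hF.flip i = hF.flip j) (h : Separates F K) :
    Connected (FourAry.restrict F K) := by
  intro u v huv
  have := h.eqvGen_step_subword (Quot.eqvGen_exact
    (hF.component_eq hK (fun i hi => by simp [FourAry.glue, hi]) huv))
  simpa using this

end

/-! ### Double-codes, connectedness and primality -/

section

variable {ι : Type*}

theorem charFun_eq_one {S : Set (Word ι)} {x : Word ι} : charFun S x = 1 ↔ x ∈ S := by
  classical
  simp [charFun, Set.indicator_apply]

theorem charFun_eq_zero {S : Set (Word ι)} {x : Word ι} : charFun S x = 0 ↔ x ∉ S := by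
  classical
  simp [charFun, Set.indicator_apply]

theorem charFun_eq_charFun {S : Set (Word ι)} {x y : Word ι} :
    charFun S x = charFun S y ↔ (x ∈ S ↔ y ∈ S) := by
  classical
  by_cases hx : x ∈ S <;> by_cases hy : y ∈ S <;> simp [charFun, hx, hy]

theorem charFun_setOf (f : Word ι → ZMod 2) : charFun {x | f x = 1} = f := by
  classical
  funext x
  have : ∀ p : ZMod 2, (if p = 1 then 1 else 0) = p := by decide
  simp only [charFun, Set.indicator_apply, Set.mem_ofPred_eq]
  exact this _

theorem self_mem_line (i : ι) (x : Word ι) : x ∈ line i x := fun _ _ => rfl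

variable [DecidableEq ι]

theorem ncard_inter_line (S : Set (Word ι)) (i : ι) (x : Word ι) :
    (S ∩ line i x).ncard = (Finset.univ.filter fun a => charFun S (update x i a) = 1).card := by
  classical
  have : S ∩ line i x = (fun a => update x i a) ''
      ((Finset.univ.filter fun a => charFun S (update x i a) = 1 : Finset (Fin 4)) :
        Set (Fin 4)) := by
    ext y
    simp only [line, charFun, Set.mem_inter_iff, Set.mem_ofPred_eq, Set.indicator_apply,
      Finset.coe_filter, Finset.mem_univ, true_and, Set.mem_image]
    constructor
    · rintro ⟨hy, h⟩
      have e : update x i (y i) = y := by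
        funext j
        by_cases hj : j = i
        · subst hj; simp
        · simp [hj, h j hj]
      exact ⟨y i, by simp [e, hy], e⟩
    · rintro ⟨a, ha, rfl⟩
      exact ⟨by simpa using ha, fun j hj => by simp [hj]⟩
  rw [this, Set.ncard_image_of_injective _ (update_injective x i), Set.ncard_coe_finset]

theorem isDoubleMDSCode_iff_balanced {S : Set (Word ι)} :
    IsDoubleMDSCode S ↔ Balanced (charFun S) := by
  constructor
  · intro h i x c
    have h1 := h i x
    rw [ncard_inter_line] at h1
    have hc : ∀ c : ZMod 2, c = 1 ∨ c = 0 := by decide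
    rcases hc c with rfl | rfl
    · exact h1
    · have h2 := Finset.card_filter_add_card_filter_not (s := (Finset.univ : Finset (Fin 4)))
        (fun a => charFun S (update x i a) = 1)
      rw [h1, Finset.card_univ, Fintype.card_fin] at h2
      have : ∀ a, charFun S (update x i a) = 0 ↔ ¬ charFun S (update x i a) = 1 := fun a => by
        rw [charFun_eq_one, charFun_eq_zero]
      simp only [this]
      omega
  · intro h i x
    rw [ncard_inter_line]
    exact h i x 1

theorem mem_line_update (i : ι) (x : Word ι) (a : Fin 4) : update x i a ∈ line i x :=
  fun j hj => by simp [hj]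

theorem finite_inter_line (S : Set (Word ι)) (i : ι) (x : Word ι) : (S ∩ line i x).Finite := by
  refine (Set.finite_range fun a => update x i a).subset ?_
  rintro y ⟨-, hy⟩
  refine ⟨y i, ?_⟩
  funext j
  by_cases hj : j = i
  · subst hj; simp
  · simp [hj, hy j hj]

/-- A part that meets a line contains both points of `S` on it, hence is closed under steps. -/
theorem isPrimeCode_of_connected {S : Set (Word ι)} (hS : IsDoubleMDSCode S)
    (hne : S.Nonempty) (h : Connected (charFun S)) : IsPrimeCode S := by
  refine ⟨⟨fun i x => .inr (hS i x), S, hS, subset_rfl⟩, hne, ?_⟩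
  rintro A B hA - hAB rfl
  have key : ∀ x y, Step (charFun (A ∪ B)) x y → x ∈ A → y ∈ A := by
    rintro x _ ⟨hxy, i, a, rfl⟩ hx
    have hne : (A ∩ line i x).ncard ≠ 0 :=
      Set.ncard_ne_zero_of_mem ⟨hx, self_mem_line i x⟩ (finite_inter_line _ _ _)
    have h2 := (hA i x).resolve_left hne
    have : A ∩ line i x = (A ∪ B) ∩ line i x :=
      Set.eq_of_subset_of_ncard_le (Set.inter_subset_inter_left _ Set.subset_union_left)
        (by rw [hS i x, h2]) (finite_inter_line _ _ _)
    have hy : update x i a ∈ (A ∪ B) ∩ line i x :=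
      ⟨(charFun_eq_charFun.1 hxy).1 (.inl hx), mem_line_update i x a⟩
    exact (this ▸ hy).1
  have key' : ∀ x y, Relation.EqvGen (Step (charFun (A ∪ B))) x y → (x ∈ A ↔ y ∈ A) := by
    intro x y hxy
    induction hxy with
    | refl => rfl
    | symm _ _ _ ih => exact ih.symm
    | trans _ _ _ _ _ ih ih' => exact ih.trans ih'
    | rel x y h => exact ⟨key x y h, key y x h.symm⟩
  by_contra! hcon
  obtain ⟨⟨x, hx⟩, y, hy⟩ := hcon
  have := (key' x y (h x y (charFun_eq_charFun.2 (by simp [hx, hy])))).1 hx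
  exact Set.disjoint_left.1 hAB this hy

/-- A double-MDS-code whose characteristic function separates the variables is not prime. -/
theorem IsPrimeCode.eq_univ_of_separates {S : Set (Word ι)} (hS : IsPrimeCode S)
    (hmds : IsDoubleMDSCode S) {M : Finset ι} (hM : M.Nonempty)
    (h : Separates (charFun S) M) : ∀ i, i ∈ M := by
  by_contra! hj
  obtain ⟨j, hj⟩ := hj
  obtain ⟨i, hi⟩ := hM
  have hF := isDoubleMDSCode_iff_balanced.1 hmds
  -- Up to a constant, `f` is the summand depending on `M`. It is constant on the points of `S` in
  -- each line, so its two level sets split `S`.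
  set f : Word ι → ZMod 2 := fun x => charFun S (M.piecewise x 0) with hf
  have hsep : ∀ x k a, charFun S (update x k a) = charFun S x → f (update x k a) = f x := by
    intro x k a hx
    by_cases hk : k ∈ M
    · have h1 := h x 0
      have h2 := h (update x k a) 0
      have : M.piecewise (0 : Word ι) (update x k a) = M.piecewise (0 : Word ι) x := by
        funext l
        by_cases hl : l ∈ M
        · simp [hl]
        · have : l ≠ k := fun e => hl (e ▸ hk)
          simp [hl, this]
      rw [this, hx, h1] at h2
      exact (add_right_cancel h2).symm
    · have : M.piecewise (update x k a) (0 : Word ι) = M.piecewise x (0 : Word ι) := by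
        funext l
        by_cases hl : l ∈ M
        · have : l ≠ k := fun e => hk (e ▸ hl)
          simp [hl, this]
        · simp [hl]
      simp only [hf, this]
  have hcode : ∀ c, IsDoubleCode {x | x ∈ S ∧ f x = c} := by
    intro c k x
    by_cases hne : ({x | x ∈ S ∧ f x = c} ∩ line k x) = ∅
    · exact .inl (by rw [hne, Set.ncard_empty])
    · right
      obtain ⟨y, ⟨hyS, hyf⟩, hy⟩ := Set.nonempty_iff_ne_empty.2 hne
      have : {x | x ∈ S ∧ f x = c} ∩ line k x = S ∩ line k x := by
        ext z
        constructor
        · rintro ⟨⟨hz, -⟩, hzl⟩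
          exact ⟨hz, hzl⟩
        · rintro ⟨hz, hzl⟩
          refine ⟨⟨hz, ?_⟩, hzl⟩
          have e : z = update y k (z k) := by
            funext l
            by_cases hl : l = k
            · subst hl; simp
            · simp [hl, hzl l hl, hy l hl]
          rw [← hyf, e]
          refine hsep _ _ _ ?_
          rw [← e, charFun_eq_charFun]
          exact ⟨fun _ => hyS, fun _ => hz⟩
      rw [this, hmds k x]
  have hne : ∀ c, {x | x ∈ S ∧ f x = c}.Nonempty := by
    intro c
    -- Coordinate `i` in `M` prescribes `f`; coordinate `j` outside `M` then brings the word into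
    -- `S`.
    obtain ⟨a, ha⟩ := hF.exists_eq i (0 : Word ι) c
    obtain ⟨b, hb⟩ := hF.exists_eq j (update (0 : Word ι) i a) 1
    refine ⟨_, charFun_eq_one.1 hb, ?_⟩
    rw [← ha]
    simp only [hf]
    congr 1
    funext l
    by_cases hl : l ∈ M
    · have : l ≠ j := fun e => hj (e ▸ hl)
      simp [hl, this]
    · have : l ≠ i := fun e => hl (e ▸ hi)
      simp [hl, this]
  have := hS.2.2 {x | x ∈ S ∧ f x = 1} {x | x ∈ S ∧ f x = 0} (hcode 1) (hcode 0) ?_ ?_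
  · rcases this with e | e
    · exact (hne 1).ne_empty e
    · exact (hne 0).ne_empty e
  · rw [Set.disjoint_left]
    rintro x ⟨-, hx⟩ ⟨-, hx'⟩
    rw [hx] at hx'
    exact one_ne_zero hx'
  · have hc : ∀ c : ZMod 2, c = 1 ∨ c = 0 := by decide
    ext x
    simp only [Set.mem_union, Set.mem_ofPred_eq, ← and_or_left]
    exact and_iff_left (hc _)

end

/-! ### Uniqueness and existence of the decomposition -/

section

variable {n : ℕ} {S : Set (Word (Fin n))}

theorem subword_piecewise_self (K : Finset (Fin n)) (x y : Word (Fin n)) :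
    subword (K.piecewise x y) K = subword x K := by
  funext i; simp [subword]

theorem subword_piecewise_of_disjoint {K L : Finset (Fin n)} (h : Disjoint K L)
    (x y : Word (Fin n)) : subword (K.piecewise x y) L = subword y L := by
  funext i
  have : i.1 ∉ K := fun hi => Finset.disjoint_left.1 h hi i.2
  simp [subword, this]

theorem Decomposition.disjoint_parts {D : Decomposition n} {K L : D.blocks.parts} (h : L ≠ K) :
    Disjoint K.1 L.1 :=
  D.blocks.disjoint K.2 L.2 fun e => h (Subtype.ext e.symm)

theorem Decomposition.Represents.separates {D : Decomposition n} (h : D.Represents S)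
    (K : D.blocks.parts) : Separates (charFun S) K.1 := by
  intro x y
  simp only [h.sum_eq]
  have : ∀ p q r s c : ZMod 2, p + q = r + s → p + c + (q + c) = r + c + (s + c) := by decide
  refine this _ _ _ _ _ ?_
  simp only [← Finset.sum_add_distrib]
  refine Finset.sum_congr rfl fun L _ => ?_
  by_cases hL : L = K
  · subst hL
    simp only [subword_piecewise_self]
  · simp only [subword_piecewise_of_disjoint (disjoint_parts hL)]
    exact add_comm _ _

/-- Since every code contains the zero word, evaluating at zero outside `K` leaves no freedom: the
code depends only on `S` and `K`. -/
theorem Decomposition.Represents.charFun_code {D : Decomposition n} (h : D.Represents S)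
    (K : D.blocks.parts) (u : Word K.1) :
    charFun (D.code K) u = restrict (charFun S) K.1 u + charFun S 0 + 1 := by
  have hsum : ∀ x : Word (Fin n), ∑ L : D.blocks.parts, charFun (D.code L) (subword x L.1) =
      charFun (D.code K) (subword x K.1) +
        ∑ L ∈ Finset.univ.erase K, charFun (D.code L) (subword x L.1) := fun x =>
    (Finset.add_sum_erase _ _ (Finset.mem_univ K)).symm
  have h0 : charFun (D.code K) (subword 0 K.1) = 1 := charFun_eq_one.2 (h.zero_mem K)
  have hrest : ∑ L ∈ Finset.univ.erase K, charFun (D.code L) (subword (glue K.1 u 0) L.1) =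
      ∑ L ∈ Finset.univ.erase K, charFun (D.code L) (subword 0 L.1) := by
    refine Finset.sum_congr rfl fun L hL => ?_
    congr 1
    funext i
    have : i.1 ∉ K.1 := fun hi =>
      Finset.disjoint_left.1 (disjoint_parts (Finset.ne_of_mem_erase hL)) hi i.2
    simp [subword, glue, this]
  rw [restrict, h.sum_eq, h.sum_eq 0, hsum, hsum 0, h0, hrest, subword_glue]
  generalize ∑ L ∈ Finset.univ.erase K, charFun (D.code L) (subword 0 L.1) = r
  generalize charFun (D.code K) u = p, D.const = c
  revert p r c; decide

/-- The code on `K` inherits the separation along `K ∩ K'`, which primality allows only if `K ∩ K' =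
K`. -/
theorem Decomposition.Represents.block_subset {D D' : Decomposition n} (h : D.Represents S)
    (h' : D'.Represents S) (K : D.blocks.parts) (K' : D'.blocks.parts) {i : Fin n}
    (hi : i ∈ K.1) (hi' : i ∈ K'.1) : K.1 ⊆ K'.1 := by
  have hsep : Separates (charFun (D.code K)) (Finset.univ.filter fun j => j.1 ∈ K'.1) := by
    intro u v
    have hglue : ∀ u v : Word K.1,
        glue K.1 ((Finset.univ.filter fun j => j.1 ∈ K'.1 : Finset K.1).piecewise u v) 0 =
          K'.1.piecewise (glue K.1 u 0) (glue K.1 v 0) := by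
      intro u v
      funext j
      by_cases hj : j ∈ K.1 <;> by_cases hj' : j ∈ K'.1 <;> simp [glue, hj, hj', Finset.piecewise]
    have := h'.separates K' (glue K.1 u 0) (glue K.1 v 0)
    rw [← hglue, ← hglue] at this
    simp only [h.charFun_code, restrict]
    have hc : ∀ p q r s c : ZMod 2, p + q = r + s →
        p + c + 1 + (q + c + 1) = r + c + 1 + (s + c + 1) := by decide
    exact hc _ _ _ _ _ this
  intro j hj
  have := (h.prime K).eq_univ_of_separates (h.double_mds K) ⟨⟨i, hi⟩, by simpa using hi'⟩ hsep
    ⟨j, hj⟩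
  simpa using this

theorem Decomposition.Represents.parts_subset {D D' : Decomposition n} (h : D.Represents S)
    (h' : D'.Represents S) : D.blocks.parts ⊆ D'.blocks.parts := by
  intro K hK
  obtain ⟨i, hi⟩ := D.blocks.nonempty_of_mem_parts hK
  obtain ⟨K', hK', hi'⟩ := D'.blocks.exists_mem (Finset.mem_univ i)
  have : K = K' := (h.block_subset h' ⟨K, hK⟩ ⟨K', hK'⟩ hi hi').antisymm
    (h'.block_subset h ⟨K', hK'⟩ ⟨K, hK⟩ hi' hi)
  exact this ▸ hK'

theorem Decomposition.Represents.unique {D D' : Decomposition n} (h : D.Represents S)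
    (h' : D'.Represents S) : D = D' := by
  have hblocks : D.blocks = D'.blocks :=
    Finpartition.ext ((h.parts_subset h').antisymm (h'.parts_subset h))
  obtain ⟨P, C, c⟩ := D
  obtain ⟨P', C', c'⟩ := D'
  dsimp only at hblocks
  subst hblocks
  have hC : C = C' := by
    funext K
    ext u
    have h1 := h.charFun_code K u
    rw [← h'.charFun_code K u] at h1
    dsimp only at h1
    rw [← charFun_eq_one, h1, charFun_eq_one]
  subst hC
  have h1 := h.sum_eq 0
  rw [h'.sum_eq 0] at h1
  have hc : c' = c := add_left_cancel h1
  rw [hc]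

theorem sum_restrict {F : Word (Fin n) → ZMod 2}
    (P : Finpartition (Finset.univ : Finset (Fin n))) (hP : ∀ K ∈ P.parts, Separates F K)
    (x : Word (Fin n)) :
    F x + F 0 = ∑ K : P.parts, (restrict F K.1 (subword x K.1) + F 0) := by
  rw [Finset.sum_coe_sort P.parts fun K => restrict F K (subword x K) + F 0]
  -- Induction on the set of blocks where `x` is not yet replaced by zero.
  have key : ∀ Q ⊆ P.parts, F ((Q.sup id).piecewise x 0) + F 0 =
      ∑ K ∈ Q, (restrict F K (subword x K) + F 0) := by
    intro Q
    induction Q using Finset.induction_on with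
    | empty =>
      intro _
      have : ∀ p : ZMod 2, p + p = 0 := by decide
      have e : ((∅ : Finset (Finset (Fin n))).sup id).piecewise x 0 = 0 := by
        funext i; simp [Finset.piecewise]
      rw [e, this, Finset.sum_empty]
    | insert K Q hK ih =>
      intro hQ
      rw [Finset.sum_insert hK, ← ih fun L hL => hQ (Finset.mem_insert_of_mem hL),
        (hP K (hQ (Finset.mem_insert_self _ _))).restrict_subword]
      have hdisj : ∀ i ∈ K, i ∉ Q.sup id := by
        intro i hi hi'
        obtain ⟨L, hL, hiL⟩ := Finset.mem_sup.1 hi'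
        exact Finset.disjoint_left.1 (P.disjoint (hQ (Finset.mem_insert_self _ _))
          (hQ (Finset.mem_insert_of_mem hL)) fun e => hK (e ▸ hL)) hi hiL
      have e1 : subword ((Finset.sup (insert K Q) id).piecewise x 0) K = subword x K := by
        funext i
        simp [subword]
      have e2 : K.piecewise (0 : Word (Fin n)) ((Finset.sup (insert K Q) id).piecewise x 0) =
          (Q.sup id).piecewise x 0 := by
        funext i
        by_cases hi : i ∈ K
        · simp [hi, hdisj i hi]
        · simp [hi, Finset.piecewise]
      rw [e1, e2]
      have : ∀ p q r : ZMod 2, p + q = p + r + (q + r) := by decide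
      exact this _ _ _
  have := key _ subset_rfl
  rw [P.sup_parts] at this
  rw [← this]
  simp

theorem exists_represents (hS : IsDoubleMDSCode S) :
    ∃ D : Decomposition n, D.Represents S ∧ ∀ K, Connected (charFun (D.code K)) := by
  classical
  have hF := isDoubleMDSCode_iff_balanced.1 hS
  set P : Finpartition (Finset.univ : Finset (Fin n)) :=
    Finpartition.ofSetoid (Setoid.ker hF.flip) with hPdef
  have hmem : ∀ K ∈ P.parts, ∀ i ∈ K, ∀ j, j ∈ K ↔ hF.flip i = hF.flip j := by
    intro K hK i hi j
    rw [← P.part_eq_of_mem hK hi, hPdef, Finpartition.mem_part_ofSetoid_iff_rel]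
    exact Iff.rfl
  have hsep : ∀ K ∈ P.parts, Separates (charFun S) K := fun K hK =>
    separates_of_mixed_difference fun i hi j hj =>
      hF.mixed_difference fun e => hj ((hmem K hK i hi j).2 e)
  have hconn : ∀ K ∈ P.parts, Connected (restrict (charFun S) K) := fun K hK =>
    hF.connected_restrict (fun i hi j hj => (hmem K hK i hi j).1 hj) (hsep K hK)
  set C : (K : P.parts) → Set (Word K.1) := fun K =>
    {u | restrict (charFun S) K.1 u + charFun S 0 + 1 = 1} with hC
  have hcode : ∀ K u, charFun (C K) u = restrict (charFun S) K.1 u + charFun S 0 + 1 :=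
    fun K u => congrFun (charFun_setOf _) u
  have hmds : ∀ K, IsDoubleMDSCode (C K) := by
    intro K
    rw [isDoubleMDSCode_iff_balanced]
    intro i u c
    have : ∀ p q r : ZMod 2, p + q + 1 = r ↔ p = r + q + 1 := by decide
    simp only [hcode, this]
    exact hF.restrict K.1 i u _
  have hconn' : ∀ K, Connected (charFun (C K)) := by
    intro K u v huv
    simp only [hcode, add_left_inj] at huv
    refine (hconn K.1 K.2 u v huv).mono ?_
    rintro u v ⟨h, h'⟩
    exact ⟨by rw [hcode, hcode, h], h'⟩
  have hzero : ∀ K, (fun _ => 0) ∈ C K := by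
    intro K
    have e : glue K.1 (fun _ => 0) 0 = 0 := by
      funext i; simp [glue]
    have : ∀ p : ZMod 2, p + p + 1 = 1 := by decide
    simp only [hC, Set.mem_ofPred_eq, restrict, e, this]
  refine ⟨⟨P, C, charFun S 0 + ∑ _K : P.parts, 1⟩, ⟨hmds, fun K => ?_, hzero, ?_⟩, hconn'⟩
  · exact isPrimeCode_of_connected (hmds K) ⟨_, hzero K⟩ (hconn' K)
  · intro x
    have h1 := sum_restrict P hsep x
    simp only [hcode]
    rw [Finset.sum_add_distrib, ← h1]
    have : ∀ p q r : ZMod 2, p = p + q + r + (q + r) := by decide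
    exact this _ _ _

end

/-! ### Composing the quasigroup from its restrictions -/

/-- The involution of the alphabet that exchanges `a` with `b`, and the other two symbols with
each other. -/
def partner (a b p : Fin 4) : Fin 4 :=
  -- The four symbols sum to `2` modulo 4, so this is the remaining symbol.
  if p = a then b else if p = b then a else 2 - a - b - p

theorem partner_ne {a b : Fin 4} (hab : a ≠ b) (p : Fin 4) : partner a b p ≠ p := by
  revert a b p; decide

theorem partner_partner {a b : Fin 4} (hab : a ≠ b) (p : Fin 4) :
    partner a b (partner a b p) = p := by
  revert a b p; decide

theorem eq_partner {a b p q : Fin 4} (hab : a ≠ b)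
    (h : (p = a ∨ p = b) ↔ (q = a ∨ q = b)) (hpq : p ≠ q) : q = partner a b p := by
  revert a b p q; decide

theorem card_pair {a b : Fin 4} (hab : a ≠ b) :
    (Finset.univ.filter fun p : Fin 4 => p = a ∨ p = b).card = 2 := by
  revert a b; decide

section

variable {ι : Type*} [DecidableEq ι] {g : Word ι → Fin 4} {a b : Fin 4}

theorem IsQuasigroup.bijective (hg : IsQuasigroup g) (i : ι) (x : Word ι) :
    Bijective fun p => g (update x i p) :=
  Finite.surjective_iff_bijective.1 (hg i x)

theorem IsQuasigroup.isDoubleMDSCode (hg : IsQuasigroup g) (hab : a ≠ b) :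
    IsDoubleMDSCode (g ⁻¹' {a, b}) := by
  intro i x
  rw [ncard_inter_line]
  refine (Finset.card_bijective _ (hg.bijective i x) fun p => ?_).trans (card_pair hab)
  simp [charFun_eq_one]

theorem IsQuasigroup.eq_partner_of_step (hg : IsQuasigroup g) (hab : a ≠ b) {x : Word ι}
    {i : ι} {p : Fin 4} (h : charFun (g ⁻¹' {a, b}) x = charFun (g ⁻¹' {a, b}) (update x i p))
    (hp : p ≠ x i) : g (update x i p) = partner a b (g x) := by
  refine eq_partner hab (by simpa using charFun_eq_charFun.1 h) fun e => hp ?_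
  refine (hg.bijective i x).1 ?_
  simpa using e.symm

end

section

variable {n : ℕ} {g : Word (Fin n) → Fin 4} {a b : Fin 4}

theorem IsQuasigroup.restrict (hg : IsQuasigroup g) (K : Finset (Fin n)) :
    IsQuasigroup (restrict g K) := by
  intro i u y
  simp only [FourAry.restrict, glue_update]
  exact hg _ _ _

/-- By separation, a step with zeros outside `K` is still a step with `w` outside. Both values of
`g` therefore undergo `partner` together. -/
theorem IsQuasigroup.eqvGen_glue (hg : IsQuasigroup g) (hab : a ≠ b) {K : Finset (Fin n)}
    (hK : Separates (charFun (g ⁻¹' {a, b})) K) (w : Word (Fin n)) {u v : Word K}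
    (h : Relation.EqvGen (Step (FourAry.restrict (charFun (g ⁻¹' {a, b})) K)) u v) :
    (FourAry.restrict g K v = FourAry.restrict g K u ∧ g (glue K v w) = g (glue K u w)) ∨
    (FourAry.restrict g K v = partner a b (FourAry.restrict g K u) ∧
      g (glue K v w) = partner a b (g (glue K u w))) := by
  induction h with
  | refl => exact .inl ⟨rfl, rfl⟩
  | symm _ _ _ ih =>
    rcases ih with ⟨h, h'⟩ | ⟨h, h'⟩
    · exact .inl ⟨h.symm, h'.symm⟩
    · exact .inr ⟨by rw [h, partner_partner hab], by rw [h', partner_partner hab]⟩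
  | trans _ _ _ _ _ ih ih' =>
    rcases ih with ⟨h1, h2⟩ | ⟨h1, h2⟩ <;> rcases ih' with ⟨h3, h4⟩ | ⟨h3, h4⟩ <;>
      simp only [h1, h2, h3, h4, partner_partner hab, and_self, true_or, or_true]
  | rel u v huv =>
    obtain ⟨huv, i, p, rfl⟩ := huv
    by_cases hp : p = u i
    · subst hp
      simp
    · have hne : ∀ w, p ≠ glue K u w i := fun w => by simpa [glue] using hp
      have h2 := hK.glue u w
      rw [huv, ← hK.glue, glue_update] at h2
      simp only [FourAry.restrict, glue_update] at huv ⊢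
      exact .inr ⟨hg.eq_partner_of_step hab huv (hne 0),
        hg.eq_partner_of_step hab (add_right_cancel h2) (hne w)⟩

/-- The value of `g` depends on the variables of `K` only through the restriction of `g`. -/
theorem IsQuasigroup.glue_eq_glue (hg : IsQuasigroup g) (hab : a ≠ b) {K : Finset (Fin n)}
    (hK : Separates (charFun (g ⁻¹' {a, b})) K)
    (hconn : Connected (FourAry.restrict (charFun (g ⁻¹' {a, b})) K)) {u v : Word K}
    (h : FourAry.restrict g K u = FourAry.restrict g K v) (w : Word (Fin n)) :
    g (glue K u w) = g (glue K v w) := by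
  have huv := hconn u v (charFun_eq_charFun.2 (by
    simp only [FourAry.restrict] at h
    simp only [Set.mem_preimage, h]))
  rcases hg.eqvGen_glue hab hK w huv with ⟨-, h'⟩ | ⟨h', -⟩
  · exact h'.symm
  -- `partner` has no fixed point, so equal restrictions exclude this case.
  · rw [← h] at h'
    exact absurd h'.symm (partner_ne hab _)

/-- Replace `x` by `y` one block at a time. -/
theorem IsQuasigroup.eq_of_restrict_eq (hg : IsQuasigroup g) (hab : a ≠ b)
    (P : Finpartition (Finset.univ : Finset (Fin n)))
    (hP : ∀ K ∈ P.parts, Separates (charFun (g ⁻¹' {a, b})) K)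
    (hconn : ∀ K ∈ P.parts, Connected (FourAry.restrict (charFun (g ⁻¹' {a, b})) K))
    {x y : Word (Fin n)}
    (h : ∀ K ∈ P.parts, FourAry.restrict g K (subword x K) = FourAry.restrict g K (subword y K)) :
    g x = g y := by
  have key : ∀ Q ⊆ P.parts, ∀ z : Word (Fin n),
      (∀ K ∈ P.parts, K ∉ Q → subword z K = subword y K) →
      (∀ K ∈ Q, subword z K = subword x K) → g z = g y := by
    intro Q
    induction Q using Finset.induction_on with
    | empty =>
      intro _ z hz _
      congr 1
      funext i
      obtain ⟨K, hK, hi⟩ := P.exists_mem (Finset.mem_univ i)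
      exact congrFun (hz K hK (Finset.notMem_empty _)) ⟨i, hi⟩
    | insert K Q hK ih =>
      intro hQ z hz hz'
      have hKP := hQ (Finset.mem_insert_self K Q)
      have e := hg.glue_eq_glue hab (hP K hKP) (hconn K hKP) (h K hKP) z
      rw [← hz' K (Finset.mem_insert_self K Q), glue_subword, Finset.piecewise_same] at e
      rw [e]
      have hdisj : ∀ L ∈ P.parts, L ≠ K → subword (glue K (subword y K) z) L = subword z L := by
        intro L hL hLK
        have hd : Disjoint K L := P.disjoint hKP hL hLK.symm
        rw [glue_subword, subword_piecewise_of_disjoint hd]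
      refine ih (fun L hL => hQ (Finset.mem_insert_of_mem hL)) _ ?_ ?_
      · intro L hL hLQ
        by_cases hLK : L = K
        · subst hLK
          exact subword_glue _ _ _
        · rw [hdisj L hL hLK, hz L hL (by simp [hLK, hLQ])]
      · intro L hL
        rw [hdisj L (hQ (Finset.mem_insert_of_mem hL)) (fun e => hK (e ▸ hL)),
          hz' L (Finset.mem_insert_of_mem hL)]
  exact key P.parts subset_rfl x (fun K hK hK' => absurd hK hK') fun _ _ => rfl

theorem IsQuasigroup.exists_composition (hg : IsQuasigroup g) (hab : a ≠ b)
    (P : Finpartition (Finset.univ : Finset (Fin n)))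
    (hP : ∀ K ∈ P.parts, Separates (charFun (g ⁻¹' {a, b})) K)
    (hconn : ∀ K ∈ P.parts, Connected (FourAry.restrict (charFun (g ⁻¹' {a, b})) K)) :
    ∃ g₀ : Word P.parts → Fin 4, IsQuasigroup g₀ ∧
      ∀ x, g x = g₀ fun K => FourAry.restrict g K.1 (subword x K.1) := by
  have hmem : ∀ K : P.parts, ∃ i, i ∈ K.1 := fun K => P.nonempty_of_mem_parts K.2
  have hsurj : ∀ v : Word P.parts, ∃ x : Word (Fin n),
      ∀ K : P.parts, FourAry.restrict g K.1 (subword x K.1) = v K := by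
    intro v
    have : ∀ K : P.parts, ∃ u : Word K.1, FourAry.restrict g K.1 u = v K := by
      intro K
      obtain ⟨i, hi⟩ := hmem K
      obtain ⟨p, hp⟩ := hg.restrict K.1 ⟨i, hi⟩ 0 (v K)
      exact ⟨_, hp⟩
    choose u hu using this
    refine ⟨fun i => u ⟨P.part i, P.part_mem.2 (Finset.mem_univ i)⟩
      ⟨i, P.mem_part (Finset.mem_univ i)⟩, fun K => ?_⟩
    rw [← hu K]
    congr 1
    funext i
    have hK : (⟨P.part i, P.part_mem.2 (Finset.mem_univ i.1)⟩ : P.parts) = K :=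
      Subtype.ext (P.part_eq_of_mem K.2 i.2)
    have aux : ∀ (L : P.parts) (hi : i.1 ∈ L.1), L = K → u L ⟨i, hi⟩ = u K i := by
      rintro L hi rfl
      rfl
    exact aux _ _ hK
  choose s hs using hsurj
  have hval : ∀ x, g x = g (s fun K => FourAry.restrict g K.1 (subword x K.1)) := fun x =>
    hg.eq_of_restrict_eq hab P hP hconn fun K hK =>
      (hs (fun K => FourAry.restrict g K.1 (subword x K.1)) ⟨K, hK⟩).symm
  refine ⟨fun v => g (s v), ?_, hval⟩
  intro K v y
  obtain ⟨i, hi⟩ := hmem K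
  -- To solve for the argument `K` of `g₀`, solve for a single coordinate of `g` in that block.
  obtain ⟨p, hp⟩ := hg i (s v) y
  refine ⟨FourAry.restrict g K.1 (subword (update (s v) i p) K.1), ?_⟩
  rw [← hp, hval (update (s v) i p)]
  congr 2
  funext L
  by_cases hL : L = K
  · subst hL
    simp
  · have : i ∉ L.1 := fun hi' => hL (Subtype.ext (P.eq_of_mem_parts L.2 K.2 hi' hi))
    rw [update_of_ne hL, subword_update_of_notMem this, hs]

end

end FourAry

theorem mainTheorem6 (n : ℕ) (hn : 1 ≤ n) (g : FourAry.Word (Fin n) → Fin 4)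
    (hg : FourAry.IsQuasigroup g) (a b : Fin 4) (hab : a ≠ b) :
    (∃! D : FourAry.Decomposition n, D.Represents (g ⁻¹' {a, b})) ∧
    ∀ D : FourAry.Decomposition n, D.Represents (g ⁻¹' {a, b}) →
      ∃ (g₀ : FourAry.Word D.blocks.parts → Fin 4)
        (g' : (K : D.blocks.parts) → FourAry.Word K.1 → Fin 4),
        FourAry.IsQuasigroup g₀ ∧ (∀ K, FourAry.IsQuasigroup (g' K)) ∧
        ∀ x : FourAry.Word (Fin n), g x = g₀ (fun K => g' K (FourAry.subword x K.1)) := by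
  obtain ⟨D, hD, hconn⟩ := FourAry.exists_represents (hg.isDoubleMDSCode hab)
  refine ⟨⟨D, hD, fun D' hD' => hD'.unique hD⟩, fun D' hD' => ?_⟩
  -- By uniqueness it suffices to treat the constructed decomposition, whose codes are known to be
  -- connected.
  obtain rfl := hD'.unique hD
  obtain ⟨g₀, hg₀, h⟩ := hg.exists_composition hab D'.blocks
    (fun K hK => hD.separates ⟨K, hK⟩) (fun K hK u v huv => by
      refine (hconn ⟨K, hK⟩ u v (by rw [hD.charFun_code, hD.charFun_code, huv])).mono ?_
      rintro u v ⟨h, h'⟩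
      rw [hD.charFun_code, hD.charFun_code, add_left_inj, add_left_inj] at h
      exact ⟨h, h'⟩)
  exact ⟨g₀, fun K => FourAry.restrict g K.1, hg₀, fun K => hg.restrict K.1, h⟩
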